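/- Let $\alpha>0$, $\alpha\neq 1$, and consider the two-dimensional Robertson–Walker spacetime $\{(t,\chi): t>0,\ \chi\in\mathbb R\}$ with metric $ds^2=-dt^2+a(t)^2d\chi^2$, $a(t)=t^\alpha$. Let $\beta_0,\beta_1,\beta_2$ be the comoving worldlines with constant coordinates $\chi=0$, $\chi=\chi_1$, $\chi=\chi_2$, where $\chi_2>\chi_1>0$, each parametrized by its proper time $t$ (so that its 4-velocity is $\partial_t$). Scenario I: $\Psi_0$ is a spacelike geodesic starting on $\beta_0$ at proper time $\tau_0$ and orthogonal to $\beta_0$ there; it meets $\beta_1$ at an event $(\tau_1,\chi_1)$ and $\beta_2$ at an event $(t_2,\chi_2)$. $\Psi_1$ is a spacelike geodesic starting on $\beta_1$ at $(\tau_1,\chi_1)$ and orthogonal to $\beta_1$ there; it meets $\beta_2$ at an event $(t_2',\chi_2)$. The kinematic velocity, relative to a comoving observer with 4-velocity $u$ at an event $p$, of a particle with 4-velocity $u'$ at an event $q$ that is joined to $p$ by a spacelike geodesic orthogonal to the observer at $p$, is the number $v$ for which the parallel transport of $u'$ along this geodesic from $q$ to $p$ equals $\gamma\,(u+v\,\mathcal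 S)$ for some scalar $\gamma$, where $\mathcal S=\frac1{a(t)}\partial_\chi$. Let $v_{\mathrm{kin}1}$ and $v_{\mathrm{kin}3}$ be the kinematic velocities of $\beta_1$ at $(\tau_1,\chi_1)$ and of $\beta_2$ at $(t_2,\chi_2)$ relative to $\beta_0$ at proper time $\tau_0$ (transport along $\Psi_0$), and let $v_{\mathrm{kin}2}$ be the kinematic velocity of $\beta_2$ at $(t_2',\chi_2)$ relative to $\beta_1$ at proper time $\tau_1$ (transport along $\Psi_1$). Put $$C_\alpha=\frac{\sqrt\pi\,\Gamma\left(\frac{1+\alpha}{2\alpha}\right)}{\Gamma\left(\frac1{2\alpha}\right)},\qquad F_\alpha(z)=z^{\frac{1-\alpha}{\alpha}}\,{}_2F_1\left(\tfrac12,\tfrac{1-\alpha}{2\alpha};\tfrac{1+\alpha}{2\alpha};z^2\right)\quad(0<z<1),$$ $$G_\alpha(v)=\left(F_\alpha^{-1}\left(C_\alpha+\tfrac{\alpha-1}{\alpha}v\right)\right)^{1/\alpha},\qquad f^{-1}(x)=\frac{\alpha}{\alpha-1}\left[F_\alpha\left(\sqrt{1-x^2}\right)-C_\alpha\right],$$ where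 ${}_2F_1$ is the Gauss hypergeometric function and $F_\alpha^{-1}$ is the inverse of $F_\alpha$ on $(0,1)$. Then $$v_{\mathrm{kin}3}=\sqrt{1-G_\alpha^{2\alpha}\left(f^{-1}(v_{\mathrm{kin}1})+\left(1-v_{\mathrm{kin}1}^2\right)^{\frac{1-\alpha}{2\alpha}}f^{-1}(v_{\mathrm{kin}2})\right)}.$$ Here all expressions are well defined: $F_\alpha$ is injective on $(0,1)$, $v_{\mathrm{kin}1},v_{\mathrm{kin}2}\in(0,1)$, and with $w$ denoting the argument of $G_\alpha^{2\alpha}$ in the formula, $C_\alpha+\frac{\alpha-1}{\alpha}w$ lies in $F_\alpha((0,1))$. -/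

import Mathlib

noncomputable section

namespace RW

/-- Events and tangent vectors in the coordinates `(t, χ)`: index `0` is the cosmological time `t`,
index `1` is the radial coordinate `χ`. -/
abbrev Vec : Type := Fin 2 → ℝ

/-- The two-dimensional Robertson-Walker metric `ds² = -dt² + a(t)² dχ²`, as the matrix of its
components at the event `p`. -/
def metric (a : ℝ → ℝ) (p : Vec) : Matrix (Fin 2) (Fin 2) ℝ :=
  Matrix.diagonal ![-1, a (p 0) ^ 2]

/-- The inner product of two tangent vectors at `p` with respect to a metric `g`. -/
def metricInner (g : Vec → Matrix (Fin 2) (Fin 2) ℝ) (p v w : Vec) : ℝ :=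
  ∑ i, ∑ j, g p i j * v i * w j

/-- The partial derivative of `φ` at `p` in the `i`-th coordinate direction. -/
def partialDeriv (i : Fin 2) (φ : Vec → ℝ) (p : Vec) : ℝ :=
  fderiv ℝ φ p (Pi.single i 1)

/-- The Christoffel symbol `Γ^k_{ij} = ½ g^{kl} (∂_i g_{jl} + ∂_j g_{il} - ∂_l g_{ij})`. -/
def christoffel (g : Vec → Matrix (Fin 2) (Fin 2) ℝ) (p : Vec) (k i j : Fin 2) : ℝ :=
  (1 / 2) * ∑ l, (g p)⁻¹ k l *
    (partialDeriv i (fun q => g q j l) p + partialDeriv j (fun q => g q i l) p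
      - partialDeriv l (fun q => g q i j) p)

/-- The vector field `V` along the curve `c : [0, 1] → spacetime` is parallel for the
Levi-Civita connection of `g`: `dV^k/ds + Γ^k_{ij}(c) (dc^i/ds) V^j = 0`. -/
def IsParallelAlong (g : Vec → Matrix (Fin 2) (Fin 2) ℝ) (c V : ℝ → Vec) : Prop :=
  ∀ s ∈ Set.Icc (0 : ℝ) 1,
    HasDerivWithinAt V
      (fun k => -∑ i, ∑ j, christoffel g (c s) k i j *
        derivWithin c (Set.Icc 0 1) s i * V s j)
      (Set.Icc 0 1) s

/-- The curve `c : [0, 1] → spacetime` is an (affinely parametrized) geodesic of `g`: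
its velocity is parallel along it. -/
def IsGeodesic (g : Vec → Matrix (Fin 2) (Fin 2) ℝ) (c : ℝ → Vec) : Prop :=
  DifferentiableOn ℝ c (Set.Icc 0 1) ∧
    IsParallelAlong g c (fun s => derivWithin c (Set.Icc 0 1) s)

/-- The worldline `τ ↦ (τ, χ)` of the comoving observer (or particle) with constant coordinate `χ`,
parametrized by its proper time. -/
def comoving (χ τ : ℝ) : Vec := ![τ, χ]

/-- The 4-velocity `∂/∂t` of a comoving observer or particle. -/
def comovingVelocity : Vec := ![1, 0]

/-- The unit vector field `𝒮 = (1 / a(t)) ∂/∂χ` at the event `p`. -/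
def unitRadial (a : ℝ → ℝ) (p : Vec) : Vec := ![0, 1 / a (p 0)]

/-- `c : [0, 1] → spacetime` is a spacelike geodesic which stays in the spacetime `{t > 0}`, starts
at proper time `τ` on the worldline of the comoving observer with coordinate `χ`, and is orthogonal
to that worldline there; that is, `c` runs in the Fermi space slice of this observer
at proper time `τ`. -/
structure IsOrthogonalGeodesic (a : ℝ → ℝ) (χ τ : ℝ) (c : ℝ → Vec) : Prop where
  time_pos : ∀ s ∈ Set.Icc (0 : ℝ) 1, 0 < c s 0
  geodesic : IsGeodesic (metric a) c
  spacelike : ∀ s ∈ Set.Icc (0 : ℝ) 1,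
    0 < metricInner (metric a) (c s) (derivWithin c (Set.Icc 0 1) s)
      (derivWithin c (Set.Icc 0 1) s)
  start : c 0 = comoving χ τ
  orthogonal : metricInner (metric a) (c 0) (derivWithin c (Set.Icc 0 1) 0) comovingVelocity = 0

/-- `v` is the (signed) kinematic velocity, relative to the comoving observer at the event `c 0`,
of a particle which has 4-velocity `u'` at the event `c s`: the parallel transport of `u'`
along the curve `c` from `c s` back to `c 0` equals `γ (u + v 𝒮)`, where `u` is the 4-velocity
of the observer and `γ` is a scalar. -/
def IsKinematicVelocity (a : ℝ → ℝ) (c : ℝ → Vec) (s : ℝ) (u' : Vec) (v : ℝ) : Prop :=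
  ∃ V : ℝ → Vec, IsParallelAlong (metric a) c V ∧ V s = u' ∧
    ∃ γ : ℝ, V 0 = γ • (comovingVelocity + v • unitRadial a (c 0))

/-- Scenario I for the comoving worldlines `β₀ = (·, 0)`, `β₁ = (·, χ₁)`, `β₂ = (·, χ₂)`.
`Ψ₀` is the spacelike geodesic orthogonal to `β₀` at proper time `τ₀`; it meets `β₁` at the event
`(τ₁, χ₁)` (parameter value `s₁`) and ends on `β₂` at the event `(t₂, χ₂)`.
`Ψ₁` is the spacelike geodesic orthogonal to `β₁` at the event `(τ₁, χ₁)`;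
it ends on `β₂` at the event `(t₂', χ₂)`. -/
structure ScenarioI (a : ℝ → ℝ) (χ₁ χ₂ τ₀ τ₁ t₂ t₂' s₁ : ℝ) (Ψ₀ Ψ₁ : ℝ → Vec) : Prop where
  geodesic₀ : IsOrthogonalGeodesic a 0 τ₀ Ψ₀
  mem_s₁ : s₁ ∈ Set.Icc (0 : ℝ) 1
  meets₁ : Ψ₀ s₁ = comoving χ₁ τ₁
  meets₂ : Ψ₀ 1 = comoving χ₂ t₂
  geodesic₁ : IsOrthogonalGeodesic a χ₁ τ₁ Ψ₁
  meets₂' : Ψ₁ 1 = comoving χ₂ t₂'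

/-- `C_α = √π Γ((1+α)/(2α)) / Γ(1/(2α))`. -/
def constC (α : ℝ) : ℝ :=
  √Real.pi * Real.Gamma ((1 + α) / (2 * α)) / Real.Gamma (1 / (2 * α))

/-- `F_α(z) = z^{(1-α)/α} ₂F₁(1/2, (1-α)/(2α); (1+α)/(2α); z²)`, for `0 < z < 1`. -/
def funF (α z : ℝ) : ℝ :=
  z ^ ((1 - α) / α) *
    ordinaryHypergeometric (1 / 2 : ℝ) ((1 - α) / (2 * α)) ((1 + α) / (2 * α)) (z ^ 2)

/-- `G_α(v) = (F_α⁻¹(C_α + (α-1)/α · v))^{1/α}`, with `F_α⁻¹` the inverse of `F_α` on `(0, 1)`. -/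
def funG (α v : ℝ) : ℝ :=
  (Function.invFunOn (funF α) (Set.Ioo 0 1) (constC α + (α - 1) / α * v)) ^ (1 / α)

/-- `f⁻¹(v_kin) = α/(α-1) · [F_α(√(1 - v_kin²)) - C_α]`. -/
def finv (α v : ℝ) : ℝ :=
  α / (α - 1) * (funF α (√(1 - v ^ 2)) - constC α)

end RW

end

/-! Along an orthogonal geodesic the Killing momentum `a² χ'` and the squared norm `-t'² + a² χ'²`
are conserved, and `t' = 0` at the start. With `z = a(t) / a(τ)` this forces `dt/dχ = -a √(1 - z²)`
on an outgoing geodesic. For `a = t^α`, `F_α` is built to integrate this equation: `F_α(z) + (1 - α)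
τ^(α-1) Δχ` is constant, and `C_α` is its value because `F_α(z) → C_α` as `z → 1`
(`RW.tendsto_funF_one`, `RW.IsOrthogonalGeodesic.funF_eq`).

Parallel transport preserves inner products, so pairing the transported 4-velocity with itself and
with the tangent of the geodesic gives `1 - v² = z²` (`RW.IsOrthogonalGeodesic.kinematicVelocity`).
Hence `f⁻¹(v) = α τ^(α-1) Δχ = a'(τ) Δχ`: in terms of `f⁻¹(v)`, velocities seen at one time `τ` add
because coordinate distances do. The second observer measures at `τ₁` instead of `τ₀`, and the power
of `1 - v₁²` in the formula is exactly the conversion factor `(τ₁/τ₀)^(1-α)`. Applying `G_α` undoes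
`f⁻¹` (`RW.funG_finv`). -/

open Filter Topology Set MeasureTheory

/-! ### Power series and differential equation of `₂F₁(1/2, b; b + 1; x)` -/

/-- The coefficient of `x ^ n` in the binomial series of `1 / √(1 - x)`. -/
noncomputable def invSqrtCoeff (n : ℕ) : ℝ := (ascPochhammer ℝ n).eval (1 / 2) / n.factorial

theorem invSqrtCoeff_zero : invSqrtCoeff 0 = 1 := by simp [invSqrtCoeff]

theorem invSqrtCoeff_succ (n : ℕ) :
    invSqrtCoeff (n + 1) = invSqrtCoeff n * ((n + 1 / 2) / (n + 1)) := by
  have h : (n.factorial : ℝ) ≠ 0 := by positivity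
  rw [invSqrtCoeff, invSqrtCoeff, ascPochhammer_succ_eval, Nat.factorial_succ]
  push_cast
  field_simp
  ring

theorem invSqrtCoeff_nonneg (n : ℕ) : 0 ≤ invSqrtCoeff n := by
  induction n with
  | zero => simp [invSqrtCoeff_zero]
  | succ n ih => rw [invSqrtCoeff_succ]; positivity

theorem invSqrtCoeff_le_one (n : ℕ) : invSqrtCoeff n ≤ 1 := by
  induction n with
  | zero => simp [invSqrtCoeff_zero]
  | succ n ih =>
    rw [invSqrtCoeff_succ]
    refine mul_le_one₀ ih (by positivity) ?_
    rw [div_le_one (by positivity)]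
    linarith

theorem invSqrtCoeff_eq_choose (n : ℕ) :
    invSqrtCoeff n = Ring.choose ((1 / 2 : ℝ) + n - 1) n := by
  have h := Ring.factorial_nsmul_multichoose_eq_ascPochhammer (1 / 2 : ℝ) n
  rw [Ring.choose]
  have e : (1 / 2 : ℝ) + n - 1 - n + 1 = 1 / 2 := by ring
  rw [e, invSqrtCoeff, div_eq_iff (by positivity)]
  rw [Polynomial.ascPochhammer_smeval_eq_eval, nsmul_eq_mul] at h
  linarith

theorem hasSum_invSqrtCoeff {x : ℝ} (hx : |x| < 1) :
    HasSum (fun n => invSqrtCoeff n * x ^ n) (1 / √(1 - x)) := by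
  have h := (Real.one_div_one_sub_rpow_hasFPowerSeriesOnBall_zero (1 / 2)).hasSum
    (y := x) (by simpa [enorm_eq_nnnorm, ← NNReal.coe_lt_coe] using hx)
  rw [zero_add, ← Real.sqrt_eq_rpow] at h
  refine h.congr_fun fun n => ?_
  simp [invSqrtCoeff_eq_choose, mul_comm]

/-- The products telescope: all factors cancel except the first above and the last below. -/
theorem ascPochhammer_eval_div_succ {b : ℝ} (hb : -1 < b) (hb0 : b ≠ 0) (n : ℕ) :
    (ascPochhammer ℝ n).eval b * ((ascPochhammer ℝ n).eval (b + 1))⁻¹ = b / (b + n) := by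
  induction n with
  | zero => simp [hb0]
  | succ n ih =>
    have h1 : b + 1 + n ≠ 0 := by have : (0 : ℝ) ≤ n := by positivity
                                  linarith
    have h2 : b + n ≠ 0 := by
      rcases n with _ | n
      · simpa using hb0
      · have : (0 : ℝ) ≤ n := by positivity
        push_cast
        linarith
    rw [ascPochhammer_succ_eval, ascPochhammer_succ_eval, mul_inv]
    rw [show ∀ p q r s : ℝ, p * q * (r * s) = (p * r) * (q * s) by intros; ring, ih]
    have h3 : b + (n + 1 : ℕ) ≠ 0 := by push_cast; convert h1 using 1; ring
    push_cast at h3 ⊢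
    field_simp
    ring

/-- `₂F₁(1/2, b; b + 1; x)` as an explicit power series. -/
theorem ordinaryHypergeometric_half_eq_tsum {b : ℝ} (hb : -1 < b) (hb0 : b ≠ 0) (x : ℝ) :
    ordinaryHypergeometric (1 / 2 : ℝ) b (b + 1) x =
      ∑' n : ℕ, invSqrtCoeff n * (b / (b + n)) * x ^ n := by
  rw [ordinaryHypergeometric_eq_tsum]
  refine tsum_congr fun n => ?_
  rw [← ascPochhammer_eval_div_succ hb hb0, invSqrtCoeff, smul_eq_mul]
  ring

/-- For `n ≥ 1` and `b > -1/2` one has `b + n ≥ n / 2`. The bound is uniform in `n`, so it dominates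
the termwise differentiated series by a geometric one. -/
theorem abs_div_add_le {b : ℝ} (hb : -(1 / 2) < b) (n : ℕ) : |n * (b / (b + n))| ≤ 2 * |b| := by
  rcases n with _ | n
  · simp
  · have h : (0 : ℝ) ≤ n := by positivity
    push_cast
    have h1 : (0 : ℝ) < b + (n + 1) := by linarith
    rw [abs_mul, abs_div, abs_of_pos h1, abs_of_pos (by positivity : (0 : ℝ) < n + 1),
      ← mul_div_assoc, div_le_iff₀ h1]
    nlinarith [abs_nonneg b]

theorem summable_hypergeometric_half {b : ℝ} (hb : -(1 / 2) < b) {x : ℝ} (hx : |x| < 1) :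
    Summable fun n : ℕ => invSqrtCoeff n * (b / (b + n)) * x ^ n := by
  rw [← summable_nat_add_iff 1]
  have hg := (summable_geometric_of_lt_one (abs_nonneg x) hx).mul_left (2 * |b|)
  rw [← summable_nat_add_iff 1] at hg
  refine Summable.of_norm_bounded hg fun n => ?_
  have h := abs_div_add_le hb (n + 1)
  have h1 : (1 : ℝ) ≤ (n + 1 : ℕ) := by push_cast; linarith [Nat.cast_nonneg (α := ℝ) n]
  rw [abs_mul, Nat.abs_cast] at h
  rw [Real.norm_eq_abs, abs_mul, abs_mul, abs_pow, abs_of_nonneg (invSqrtCoeff_nonneg _)]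
  refine mul_le_mul_of_nonneg_right (le_trans ?_ h) (by positivity)
  exact mul_le_mul_of_nonneg_right ((invSqrtCoeff_le_one _).trans h1) (abs_nonneg _)

/-- The derivative of `₂F₁(1/2, b; b + 1; ·)`, in the form of the differential equation
`x f' + b f = b / √(1 - x)`. -/
theorem exists_hasDerivAt_hypergeometric_half {b : ℝ} (hb : -(1 / 2) < b) (hb0 : b ≠ 0)
    {x : ℝ} (hx : |x| < 1) :
    ∃ f', HasDerivAt (fun y => ordinaryHypergeometric (1 / 2 : ℝ) b (b + 1) y) f' x ∧
      x * f' + b * ordinaryHypergeometric (1 / 2 : ℝ) b (b + 1) x = b / √(1 - x) := by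
  obtain ⟨r, hxr, hr⟩ := exists_between hx
  have hr0 : 0 < r := (abs_nonneg x).trans_lt hxr
  have hu : Summable fun n : ℕ => 2 * |b| * r ^ (n - 1) := by
    refine Summable.mul_left _ ?_
    rw [← summable_nat_add_iff 1]
    simpa using summable_geometric_of_lt_one hr0.le hr
  have hd := hasDerivAt_tsum_of_isPreconnected (𝕜 := ℝ) (F := ℝ)
    (g := fun (n : ℕ) y => invSqrtCoeff n * (b / (b + n)) * y ^ n)
    (g' := fun (n : ℕ) y => invSqrtCoeff n * (b / (b + n)) * (n * y ^ (n - 1)))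
    (t := Ioo (-r) r) (y₀ := 0) (y := x) hu isOpen_Ioo isPreconnected_Ioo
    (fun n y _ => (hasDerivAt_pow n y).const_mul _)
    (fun n y hy => by
      have hy' : |y| ≤ r := abs_le.2 ⟨hy.1.le, hy.2.le⟩
      -- The factor `n` from differentiation is grouped with `b / (b + n)`, so no polynomial growth
      -- remains to be beaten.
      rw [Real.norm_eq_abs,
        show invSqrtCoeff n * (b / (b + n)) * (n * y ^ (n - 1)) =
          invSqrtCoeff n * (n * (b / (b + n)) * y ^ (n - 1)) by ring,
        abs_mul, abs_of_nonneg (invSqrtCoeff_nonneg n), abs_mul, abs_pow]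
      calc _ ≤ 1 * (|n * (b / (b + n))| * |y| ^ (n - 1)) := by
            gcongr; exact invSqrtCoeff_le_one n
        _ ≤ _ := by rw [one_mul]; gcongr; exact abs_div_add_le hb n)
    (by simp [hr0]) (summable_hypergeometric_half hb (by simp)) (abs_lt.1 hxr)
  have hd' : Summable fun n : ℕ => invSqrtCoeff n * (b / (b + n)) * (n * x ^ (n - 1)) := by
    refine Summable.of_norm_bounded hu fun n => ?_
    rw [Real.norm_eq_abs,
      show invSqrtCoeff n * (b / (b + n)) * (n * x ^ (n - 1)) =
        invSqrtCoeff n * (n * (b / (b + n)) * x ^ (n - 1)) by ring,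
      abs_mul, abs_of_nonneg (invSqrtCoeff_nonneg n), abs_mul, abs_pow]
    calc _ ≤ 1 * (|n * (b / (b + n))| * |x| ^ (n - 1)) := by
          gcongr; exact invSqrtCoeff_le_one n
      _ ≤ _ := by rw [one_mul]; gcongr; exact abs_div_add_le hb n
  have hf : (fun y => ordinaryHypergeometric (1 / 2 : ℝ) b (b + 1) y) =
      fun y => ∑' n : ℕ, invSqrtCoeff n * (b / (b + n)) * y ^ n :=
    funext (ordinaryHypergeometric_half_eq_tsum (by linarith) hb0)
  refine ⟨_, hf ▸ hd, ?_⟩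
  rw [ordinaryHypergeometric_half_eq_tsum (by linarith) hb0]
  refine HasSum.unique ((hd'.hasSum.mul_left x).add
    ((summable_hypergeometric_half hb hx).hasSum.mul_left b)) ?_
  -- In `x f' + b f` the coefficient `b / (b + n)` is multiplied by `n + b`, leaving `b` times the
  -- binomial series.
  have h := (hasSum_invSqrtCoeff hx).mul_left b
  rw [mul_one_div] at h
  convert h using 2 with n
  rcases n with _ | n
  · simp [hb0]
  · have h1 : b + (n + 1 : ℕ) ≠ 0 := by
      push_cast; linarith [Nat.cast_nonneg (α := ℝ) n]
    rw [Nat.add_sub_cancel, pow_succ]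
    field_simp
    ring

/-- This carries Gauss's formula from `b + 1 > 0` back to `-1/2 < b < 0` (the case `α > 1`), where
the beta integral for `b` diverges. It follows by comparing coefficients of `x^(n+1)` after writing
`√(1 - x) = (1 - x) / √(1 - x)`. -/
theorem hypergeometric_half_recurrence {b : ℝ} (hb : -(1 / 2) < b) (hb0 : b ≠ 0)
    {x : ℝ} (hx : |x| < 1) :
    ordinaryHypergeometric (1 / 2 : ℝ) b (b + 1) x = √(1 - x) +
      (b + 1 / 2) / (b + 1) * x * ordinaryHypergeometric (1 / 2 : ℝ) (b + 1) (b + 1 + 1) x := by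
  have hs : 0 < 1 - x := by linarith [(abs_lt.1 hx).2]
  rw [ordinaryHypergeometric_half_eq_tsum (by linarith) hb0,
    ordinaryHypergeometric_half_eq_tsum (by linarith) (by linarith)]
  have h0 := hasSum_invSqrtCoeff hx
  have h1 : HasSum (fun n : ℕ => invSqrtCoeff (n + 1) * x ^ (n + 1)) (1 / √(1 - x) - 1) := by
    have := (hasSum_nat_add_iff' 1).2 h0
    simpa [invSqrtCoeff_zero] using this
  have h2 := (summable_hypergeometric_half (b := b + 1) (by linarith) hx).hasSum.mul_left
    ((b + 1 / 2) / (b + 1) * x)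
  have h3 := (h1.sub (h0.mul_left x)).add h2
  have h4 := (hasSum_nat_add_iff' (f := fun n : ℕ => invSqrtCoeff n * (b / (b + n)) * x ^ n) 1).2
    (summable_hypergeometric_half hb hx).hasSum
  have h5 := h4.unique (h3.congr_fun ?_)
  · simp only [Finset.range_one, Finset.sum_singleton, invSqrtCoeff_zero] at h5
    have e : √(1 - x) = 1 / √(1 - x) - x * (1 / √(1 - x)) := by
      rw [← one_sub_mul, mul_one_div, Real.div_sqrt]
    simp [hb0] at h5
    rw [e]
    simp
    linarith
  · intro n
    have hn : (0 : ℝ) ≤ n := by positivity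
    have e1 : b + (n + 1 : ℕ) ≠ 0 := by push_cast; linarith
    have e2 : b + 1 + (n : ℝ) ≠ 0 := by linarith
    have e3 : b + 1 ≠ 0 := by linarith
    have e4 : (n : ℝ) + 1 ≠ 0 := by linarith
    rw [invSqrtCoeff_succ, pow_succ]
    push_cast at e1 ⊢
    field_simp
    ring

theorem continuousOn_hypergeometric_half {b : ℝ} (hb : -(1 / 2) < b) (hb0 : b ≠ 0) :
    ContinuousOn (fun y => ordinaryHypergeometric (1 / 2 : ℝ) b (b + 1) y) (Ioo (-1 : ℝ) 1) := by
  intro x hx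
  obtain ⟨f', hf, -⟩ := exists_hasDerivAt_hypergeometric_half hb hb0 (abs_lt.2 hx)
  exact hf.continuousAt.continuousWithinAt

/-- `x^b` is the integrating factor of `x f' + b f = b / √(1 - x)`. -/
theorem hasDerivAt_rpow_mul_hypergeometric_half {b : ℝ} (hb : -(1 / 2) < b) (hb0 : b ≠ 0)
    {x : ℝ} (hx : x ∈ Ioo (0 : ℝ) 1) :
    HasDerivAt (fun y => y ^ b * ordinaryHypergeometric (1 / 2 : ℝ) b (b + 1) y)
      (b * x ^ (b - 1) / √(1 - x)) x := by
  obtain ⟨f', hf, he⟩ := exists_hasDerivAt_hypergeometric_half hb hb0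
    (abs_lt.2 ⟨by linarith [hx.1], hx.2⟩)
  refine ((Real.hasDerivAt_rpow_const (p := b) (Or.inl hx.1.ne')).mul hf).congr_deriv ?_
  have e : x ^ b = x ^ (b - 1) * x := by
    rw [← Real.rpow_add_one hx.1.ne', sub_add_cancel]
  rw [mul_comm b, mul_div_assoc, ← he, e]
  ring

/-! ### Beta integrals and the limit at `x = 1` -/

theorem intervalIntegrable_beta {u v : ℝ} (hu : 0 < u) (hv : 0 < v) :
    IntervalIntegrable (fun x : ℝ => x ^ (u - 1) * (1 - x) ^ (v - 1)) volume 0 1 := by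
  have h := Complex.betaIntegral_convergent (u := u) (v := v) (by simpa) (by simpa)
  rw [intervalIntegrable_iff_integrableOn_Ioc_of_le zero_le_one] at h ⊢
  refine IntegrableOn.congr_fun
    (f := fun x : ℝ => ((x : ℂ) ^ ((u : ℂ) - 1) * (1 - (x : ℂ)) ^ ((v : ℂ) - 1)).re) h.re
    (fun x hx => ?_) measurableSet_Ioc
  have h1 : (0 : ℝ) ≤ 1 - x := by linarith [hx.2]
  simp only
  norm_cast
  rw [← Complex.ofReal_cpow hx.1.le, ← Complex.ofReal_cpow h1, ← Complex.ofReal_mul,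
    Complex.ofReal_re]

theorem integral_beta {u v : ℝ} (hu : 0 < u) (hv : 0 < v) :
    ∫ x in (0 : ℝ)..1, x ^ (u - 1) * (1 - x) ^ (v - 1) =
      Real.Gamma u * Real.Gamma v / Real.Gamma (u + v) := by
  have h := ProbabilityTheory.beta_eq_betaIntegralReal u v hu hv
  have e : Complex.betaIntegral u v =
      ((∫ x in (0 : ℝ)..1, x ^ (u - 1) * (1 - x) ^ (v - 1) : ℝ) : ℂ) := by
    rw [Complex.betaIntegral, ← intervalIntegral.integral_ofReal]
    refine intervalIntegral.integral_congr fun x hx => ?_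
    rw [uIcc_of_le zero_le_one] at hx
    have h1 : (0 : ℝ) ≤ 1 - x := by linarith [hx.2]
    rw [Complex.ofReal_mul, Complex.ofReal_cpow hx.1, Complex.ofReal_cpow h1]
    push_cast
    rfl
  rw [e, Complex.ofReal_re] at h
  exact h.symm

/-- For `b > 0` the function `x^b ₂F₁` vanishes at `0`, so it equals `∫₀ˣ b t^(b-1) (1 - t)^(-1/2)
dt`; as `x → 1` this tends to `b B(b, 1/2)`. -/
theorem tendsto_hypergeometric_half_of_pos {b : ℝ} (hb : 0 < b) :
    Tendsto (fun x => ordinaryHypergeometric (1 / 2 : ℝ) b (b + 1) x) (𝓝[<] 1)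
      (𝓝 (√Real.pi * Real.Gamma (b + 1) / Real.Gamma (b + 1 / 2))) := by
  set g : ℝ → ℝ := fun x => b * (x ^ (b - 1) * (1 - x) ^ (1 / 2 - 1 : ℝ)) with hg
  have hint : IntervalIntegrable g volume 0 1 :=
    (intervalIntegrable_beta hb one_half_pos).const_mul b
  have hval : ∫ x in (0 : ℝ)..1, g x =
      √Real.pi * Real.Gamma (b + 1) / Real.Gamma (b + 1 / 2) := by
    rw [intervalIntegral.integral_const_mul, integral_beta hb one_half_pos,
      Real.Gamma_one_half_eq, Real.Gamma_add_one hb.ne']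
    ring
  have hcont := intervalIntegral.continuousOn_primitive_interval (a := 0) (b := 1) (f := g)
    (μ := volume) (by
      rw [uIcc_of_le zero_le_one]
      exact (intervalIntegrable_iff_integrableOn_Icc_of_le zero_le_one).1 hint)
  have hlim : Tendsto (fun x => ∫ t in (0 : ℝ)..x, g t) (𝓝[<] 1) (𝓝 (∫ t in (0 : ℝ)..1, g t)) := by
    refine ((hcont 1 (by simp)).mono_left ?_)
    rw [uIcc_of_le zero_le_one]
    rw [← nhdsWithin_Ioo_eq_nhdsLT zero_lt_one]
    exact nhdsWithin_mono _ Ioo_subset_Icc_self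
  have hpow : Tendsto (fun x : ℝ => x ^ (-b)) (𝓝[<] 1) (𝓝 1) := by
    have := (Real.continuousAt_rpow_const 1 (-b) (Or.inl one_ne_zero)).tendsto
    rw [Real.one_rpow] at this
    exact this.mono_left nhdsWithin_le_nhds
  rw [← hval, ← one_mul (∫ t in (0 : ℝ)..1, g t)]
  refine (hpow.mul hlim).congr' ?_
  rw [← nhdsWithin_Ioo_eq_nhdsLT zero_lt_one]
  filter_upwards [self_mem_nhdsWithin] with x hx
  have hsub : Icc 0 x ⊆ Ioo (-1) 1 := fun y hy => ⟨by linarith [hy.1], hy.2.trans_lt hx.2⟩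
  rw [intervalIntegral.integral_eq_sub_of_hasDerivAt_of_le hx.1.le
    (f := fun y => y ^ b * ordinaryHypergeometric (1 / 2 : ℝ) b (b + 1) y)]
  · simp only [Real.zero_rpow hb.ne', zero_mul, sub_zero]
    rw [← mul_assoc, ← Real.rpow_add hx.1]
    simp
  · exact (Real.continuous_rpow_const hb.le).continuousOn.mul
      ((continuousOn_hypergeometric_half (by linarith) hb.ne').mono hsub)
  · intro y hy
    have hy1 : y < 1 := hy.2.trans hx.2
    refine (hasDerivAt_rpow_mul_hypergeometric_half (by linarith) hb.ne'
      ⟨hy.1, hy1⟩).congr_deriv ?_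
    simp only [hg]
    rw [show (1 / 2 - 1 : ℝ) = -(1 / 2) by norm_num, Real.rpow_neg (by linarith),
      ← Real.sqrt_eq_rpow]
    ring
  · refine hint.mono_set ?_
    rw [uIcc_of_le hx.1.le, uIcc_of_le zero_le_one]
    exact Icc_subset_Icc_right hx.2.le

/-- Gauss's summation formula for `₂F₁(1/2, b; b + 1; 1)`. -/
theorem tendsto_hypergeometric_half {b : ℝ} (hb : -(1 / 2) < b) (hb0 : b ≠ 0) :
    Tendsto (fun x => ordinaryHypergeometric (1 / 2 : ℝ) b (b + 1) x) (𝓝[<] 1)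
      (𝓝 (√Real.pi * Real.Gamma (b + 1) / Real.Gamma (b + 1 / 2))) := by
  have h := tendsto_hypergeometric_half_of_pos (b := b + 1) (by linarith)
  have hx : Tendsto (fun x : ℝ => x) (𝓝[<] 1) (𝓝 1) := tendsto_id.mono_left nhdsWithin_le_nhds
  have hs : Tendsto (fun x : ℝ => √(1 - x)) (𝓝[<] 1) (𝓝 √(1 - 1)) := (hx.const_sub 1).sqrt
  have h2 := hs.add ((hx.const_mul ((b + 1 / 2) / (b + 1))).mul h)
  have e : √(1 - 1) + (b + 1 / 2) / (b + 1) * 1 *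
      (√Real.pi * Real.Gamma (b + 1 + 1) / Real.Gamma (b + 1 + 1 / 2)) =
      √Real.pi * Real.Gamma (b + 1) / Real.Gamma (b + 1 / 2) := by
    have h1 : b + 1 ≠ 0 := by linarith
    have h3 : b + 1 / 2 ≠ 0 := by linarith
    have h4 : Real.Gamma (b + 1 / 2) ≠ 0 := (Real.Gamma_pos_of_pos (by linarith)).ne'
    rw [Real.Gamma_add_one h1, show b + 1 + 1 / 2 = b + 1 / 2 + 1 by ring,
      Real.Gamma_add_one h3, sub_self, Real.sqrt_zero, zero_add, div_mul_eq_mul_div, mul_one]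
    rw [div_mul_div_comm, div_eq_div_iff (mul_ne_zero h1 (mul_ne_zero h3 h4)) h4]
    ring
  rw [e] at h2
  refine h2.congr' ?_
  rw [← nhdsWithin_Ioo_eq_nhdsLT zero_lt_one]
  filter_upwards [self_mem_nhdsWithin] with x hx
  exact (hypergeometric_half_recurrence hb hb0 (abs_lt.2 ⟨by linarith [hx.1], hx.2⟩)).symm

/-! ### The function `F_α`: derivative, limit at `1`, injectivity -/

namespace RW

/-- The parameter is `b = 1/(2α) - 1/2`, so `α > 0` is exactly the range `b > -1/2` of the lemmas on
`₂F₁`. -/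
theorem half_exponent_bounds {α : ℝ} (hα : 0 < α) (hα1 : α ≠ 1) :
    -(1 / 2) < (1 - α) / (2 * α) ∧ (1 - α) / (2 * α) ≠ 0 ∧
      (1 + α) / (2 * α) = (1 - α) / (2 * α) + 1 := by
  refine ⟨?_, div_ne_zero (sub_ne_zero.2 hα1.symm) (by positivity), by field_simp; ring⟩
  rw [lt_div_iff₀ (by positivity)]
  linarith

theorem funF_eq {α z : ℝ} (hα : 0 < α) (hα1 : α ≠ 1) (hz : 0 < z) :
    funF α z = (z ^ 2) ^ ((1 - α) / (2 * α)) * ordinaryHypergeometric (1 / 2 : ℝ)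
      ((1 - α) / (2 * α)) ((1 - α) / (2 * α) + 1) (z ^ 2) := by
  rw [funF, (half_exponent_bounds hα hα1).2.2, ← Real.rpow_natCast, ← Real.rpow_mul hz.le]
  congr 2
  push_cast
  field_simp

theorem hasDerivAt_funF {α z : ℝ} (hα : 0 < α) (hα1 : α ≠ 1) (hz : z ∈ Ioo (0 : ℝ) 1) :
    HasDerivAt (funF α) ((1 - α) / α * z ^ ((1 - α) / α - 1) / √(1 - z ^ 2)) z := by
  obtain ⟨hb, hb0, -⟩ := half_exponent_bounds hα hα1
  have hz2 : z ^ 2 ∈ Ioo (0 : ℝ) 1 := ⟨by have := hz.1; positivity, by nlinarith [hz.1, hz.2]⟩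
  have h := (hasDerivAt_rpow_mul_hypergeometric_half hb hb0 hz2).comp z
    (h := fun y : ℝ => y ^ 2) (hasDerivAt_pow 2 z)
  have h' := h.congr_of_eventuallyEq (f₁ := funF α) (by
    filter_upwards [lt_mem_nhds hz.1] with y hy
    exact funF_eq hα hα1 hy)
  refine h'.congr_deriv ?_
  rw [← Real.rpow_natCast z 2, ← Real.rpow_mul hz.1.le, Real.rpow_natCast]
  have e : ((2 : ℕ) : ℝ) * ((1 - α) / (2 * α) - 1) = (1 - α) / α - 1 - 1 := by
    push_cast; field_simp; ring
  rw [e, Real.rpow_sub_one hz.1.ne' ((1 - α) / α - 1)]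
  have := hz.1.ne'
  push_cast
  field_simp

theorem tendsto_funF_one {α : ℝ} (hα : 0 < α) (hα1 : α ≠ 1) :
    Tendsto (funF α) (𝓝[<] 1) (𝓝 (constC α)) := by
  obtain ⟨hb, hb0, hb1⟩ := half_exponent_bounds hα hα1
  have hz : Tendsto (fun z : ℝ => z) (𝓝[<] 1) (𝓝 1) := tendsto_id.mono_left nhdsWithin_le_nhds
  have h1 : Tendsto (fun z : ℝ => z ^ 2) (𝓝[<] 1) (𝓝[<] 1) := by
    refine tendsto_nhdsWithin_iff.2 ⟨by simpa using hz.pow 2, ?_⟩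
    rw [← nhdsWithin_Ioo_eq_nhdsLT zero_lt_one]
    filter_upwards [self_mem_nhdsWithin] with z hz
    exact pow_lt_one₀ hz.1.le hz.2 two_ne_zero
  have h2 := (tendsto_hypergeometric_half hb hb0).comp h1
  have h3 : Tendsto (fun z : ℝ => z ^ ((1 - α) / α)) (𝓝[<] 1) (𝓝 1) := by
    simpa using hz.rpow_const (p := (1 - α) / α) (Or.inl one_ne_zero)
  have h4 := h3.mul h2
  rw [one_mul, ← hb1, show (1 - α) / (2 * α) + 1 / 2 = 1 / (2 * α) by field_simp; ring] at h4
  exact h4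

/-- The derivative has the constant sign of `1 - α`. -/
theorem injOn_funF {α : ℝ} (hα : 0 < α) (hα1 : α ≠ 1) : InjOn (funF α) (Ioo 0 1) := by
  have hc : ContinuousOn (funF α) (Ioo 0 1) := fun z hz =>
    (hasDerivAt_funF hα hα1 hz).continuousAt.continuousWithinAt
  have hpos : ∀ z ∈ Ioo (0 : ℝ) 1, 0 < z ^ ((1 - α) / α - 1) / √(1 - z ^ 2) := fun z hz =>
    div_pos (Real.rpow_pos_of_pos hz.1 _) (Real.sqrt_pos.2 (by nlinarith [hz.1, hz.2]))
  rcases lt_or_gt_of_ne hα1 with h | h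
  · refine (strictMonoOn_of_deriv_pos (convex_Ioo 0 1) hc fun z hz => ?_).injOn
    rw [interior_Ioo] at hz
    rw [(hasDerivAt_funF hα hα1 hz).deriv, mul_div_assoc]
    exact mul_pos (div_pos (by linarith) hα) (hpos z hz)
  · refine (strictAntiOn_of_deriv_neg (convex_Ioo 0 1) hc fun z hz => ?_).injOn
    rw [interior_Ioo] at hz
    rw [(hasDerivAt_funF hα hα1 hz).deriv, mul_div_assoc]
    exact mul_neg_of_neg_of_pos (div_neg_of_neg_of_pos (by linarith) hα) (hpos z hz)

end RW

/-! ### Parallel transport and orthogonal geodesics for a general scale factor -/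

namespace RW

theorem partialDeriv_metric {a : ℝ → ℝ} {a' : ℝ} {p : Vec} (ha : HasDerivAt a a' (p 0))
    (i j k : Fin 2) :
    partialDeriv i (fun q => metric a q j k) p =
      if i = 0 ∧ j = 1 ∧ k = 1 then 2 * a (p 0) * a' else 0 := by
  have h : HasFDerivAt (fun q : Vec => a (q 0) ^ 2)
      ((2 * a (p 0) * a') • (ContinuousLinearMap.proj 0 : Vec →L[ℝ] ℝ)) p := by
    have h1 : HasDerivAt (fun t => a t ^ 2) (2 * a (p 0) * a') (p 0) :=
      (ha.pow 2).congr_deriv (by norm_num)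
    exact h1.comp_hasFDerivAt p (ContinuousLinearMap.proj 0 : Vec →L[ℝ] ℝ).hasFDerivAt
  fin_cases j <;> fin_cases k <;> simp [metric, partialDeriv]
  rw [h.fderiv]
  fin_cases i <;> simp

theorem inv_metric {a : ℝ → ℝ} {p : Vec} (ha : a (p 0) ≠ 0) :
    (metric a p)⁻¹ = Matrix.diagonal ![-1, (a (p 0) ^ 2)⁻¹] := by
  refine Matrix.inv_eq_right_inv ?_
  rw [metric, Matrix.diagonal_mul_diagonal, ← Matrix.diagonal_one]
  congr 1
  ext i
  fin_cases i <;> simp [ha]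

/-- Parallel transport in a Robertson-Walker spacetime, in coordinates. -/
theorem IsParallelAlong.hasDerivWithinAt {a : ℝ → ℝ} {c V : ℝ → Vec}
    (hV : IsParallelAlong (metric a) c V) {s a' : ℝ} (hs : s ∈ Icc (0 : ℝ) 1)
    (ha : HasDerivAt a a' (c s 0)) (ha0 : a (c s 0) ≠ 0) :
    HasDerivWithinAt (fun s => V s 0)
      (-(a (c s 0) * a' * derivWithin c (Icc 0 1) s 1 * V s 1)) (Icc 0 1) s ∧
    HasDerivWithinAt (fun s => V s 1)
      (-(a' / a (c s 0) * (derivWithin c (Icc 0 1) s 0 * V s 1 +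
        derivWithin c (Icc 0 1) s 1 * V s 0))) (Icc 0 1) s := by
  have h := hasDerivWithinAt_pi.1 (hV s hs)
  constructor
  · refine (h 0).congr_deriv ?_
    simp [christoffel, Fin.sum_univ_two, partialDeriv_metric ha, inv_metric ha0,
      -mul_eq_mul_right_iff]
    ring
  · refine (h 1).congr_deriv ?_
    simp [christoffel, Fin.sum_univ_two, partialDeriv_metric ha, inv_metric ha0]
    field_simp
    ring

theorem metricInner_metric (a : ℝ → ℝ) (p v w : Vec) :
    metricInner (metric a) p v w = -(v 0 * w 0) + a (p 0) ^ 2 * (v 1 * w 1) := by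
  simp [metricInner, metric, Fin.sum_univ_two]
  ring

theorem eq_of_hasDerivWithinAt_zero {f : ℝ → ℝ}
    (hf : ∀ s ∈ Icc (0 : ℝ) 1, HasDerivWithinAt f 0 (Icc 0 1) s) {s : ℝ}
    (hs : s ∈ Icc (0 : ℝ) 1) : f s = f 0 :=
  constant_of_derivWithin_zero (fun x hx => (hf x hx).differentiableWithinAt)
    (fun x hx => (hf x (Ico_subset_Icc_self hx)).derivWithin
      (uniqueDiffOn_Icc zero_lt_one x (Ico_subset_Icc_self hx))) s hs

section Curve

variable {a a' : ℝ → ℝ} {c : ℝ → Vec}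

theorem hasDerivWithinAt_coord (hc : DifferentiableOn ℝ c (Icc 0 1)) {s : ℝ}
    (hs : s ∈ Icc (0 : ℝ) 1) (i : Fin 2) :
    HasDerivWithinAt (fun s => c s i) (derivWithin c (Icc 0 1) s i) (Icc 0 1) s :=
  hasDerivWithinAt_pi.1 (hc s hs).hasDerivWithinAt i

theorem hasDerivWithinAt_scale (hc : DifferentiableOn ℝ c (Icc 0 1)) {s : ℝ}
    (hs : s ∈ Icc (0 : ℝ) 1) (ha : HasDerivAt a (a' (c s 0)) (c s 0)) :
    HasDerivWithinAt (fun s => a (c s 0)) (a' (c s 0) * derivWithin c (Icc 0 1) s 0)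
      (Icc 0 1) s :=
  ha.comp_hasDerivWithinAt s (hasDerivWithinAt_coord hc hs 0)

/-- Parallel transport preserves the metric. -/
theorem metricInner_eq_of_parallel (hc : DifferentiableOn ℝ c (Icc 0 1))
    (ha : ∀ s ∈ Icc (0 : ℝ) 1, HasDerivAt a (a' (c s 0)) (c s 0))
    (ha0 : ∀ s ∈ Icc (0 : ℝ) 1, a (c s 0) ≠ 0) {V W : ℝ → Vec}
    (hV : IsParallelAlong (metric a) c V) (hW : IsParallelAlong (metric a) c W) {s : ℝ}
    (hs : s ∈ Icc (0 : ℝ) 1) :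
    metricInner (metric a) (c s) (V s) (W s) = metricInner (metric a) (c 0) (V 0) (W 0) := by
  refine eq_of_hasDerivWithinAt_zero
    (f := fun s => metricInner (metric a) (c s) (V s) (W s)) (fun s hs => ?_) hs
  simp only [metricInner_metric]
  obtain ⟨hV0, hV1⟩ := hV.hasDerivWithinAt hs (ha s hs) (ha0 s hs)
  obtain ⟨hW0, hW1⟩ := hW.hasDerivWithinAt hs (ha s hs) (ha0 s hs)
  refine ((hV0.mul hW0).neg.add (((hasDerivWithinAt_scale hc hs (ha s hs)).pow 2).mul
    (hV1.mul hW1))).congr_deriv ?_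
  have := ha0 s hs
  simp only [Pi.pow_apply, Pi.mul_apply]
  push_cast
  field_simp
  ring

/-- The conserved momentum of a geodesic associated with the Killing field `∂/∂χ`. -/
theorem momentum_eq_of_geodesic
    (ha : ∀ s ∈ Icc (0 : ℝ) 1, HasDerivAt a (a' (c s 0)) (c s 0))
    (ha0 : ∀ s ∈ Icc (0 : ℝ) 1, a (c s 0) ≠ 0) (hc : IsGeodesic (metric a) c) {s : ℝ}
    (hs : s ∈ Icc (0 : ℝ) 1) :
    a (c s 0) ^ 2 * derivWithin c (Icc 0 1) s 1 = a (c 0 0) ^ 2 * derivWithin c (Icc 0 1) 0 1 := by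
  refine eq_of_hasDerivWithinAt_zero
    (f := fun s => a (c s 0) ^ 2 * derivWithin c (Icc 0 1) s 1) (fun s hs => ?_) hs
  obtain ⟨-, hu⟩ := hc.2.hasDerivWithinAt hs (ha s hs) (ha0 s hs)
  refine (((hasDerivWithinAt_scale hc.1 hs (ha s hs)).pow 2).mul hu).congr_deriv ?_
  have := ha0 s hs
  simp only [Pi.pow_apply]
  push_cast
  field_simp
  ring

theorem strictAntiOn_of_hasDerivWithinAt_neg {f f' : ℝ → ℝ}
    (hf : ∀ s ∈ Icc (0 : ℝ) 1, HasDerivWithinAt f (f' s) (Icc 0 1) s)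
    (hf' : ∀ s ∈ Ioo (0 : ℝ) 1, f' s < 0) : StrictAntiOn f (Icc 0 1) := by
  refine strictAntiOn_of_deriv_neg (convex_Icc 0 1)
    (fun s hs => (hf s hs).continuousWithinAt) fun s hs => ?_
  rw [interior_Icc] at hs
  rw [((hf s (Ioo_subset_Icc_self hs)).hasDerivAt (Icc_mem_nhds hs.1 hs.2)).deriv]
  exact hf' s hs

/-- The kinematics of an outgoing spacelike geodesic orthogonal to a comoving observer in an
expanding Robertson-Walker spacetime. -/
theorem IsOrthogonalGeodesic.kinematics {χ τ : ℝ} (hc : IsOrthogonalGeodesic a χ τ c)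
    (ha : ∀ t, 0 < t → HasDerivAt a (a' t) t) (hpos : ∀ t, 0 < t → 0 < a t)
    (hpos' : ∀ t, 0 < t → 0 < a' t) {s₀ : ℝ} (hs₀ : s₀ ∈ Icc (0 : ℝ) 1) (hχ : χ < c s₀ 1) :
    0 < derivWithin c (Icc 0 1) 0 1 ∧
    ∀ s ∈ Ioc (0 : ℝ) 1, 0 < c s 0 ∧ c s 0 < τ ∧ derivWithin c (Icc 0 1) s 0 < 0 ∧
      a (c s 0) ^ 2 * derivWithin c (Icc 0 1) s 1 = a τ ^ 2 * derivWithin c (Icc 0 1) 0 1 ∧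
      -(derivWithin c (Icc 0 1) s 0) ^ 2 + a (c s 0) ^ 2 * (derivWithin c (Icc 0 1) s 1) ^ 2 =
        a τ ^ 2 * (derivWithin c (Icc 0 1) 0 1) ^ 2 := by
  have h0 : (0 : ℝ) ∈ Icc (0 : ℝ) 1 := by simp
  have ha1 : ∀ s ∈ Icc (0 : ℝ) 1, HasDerivAt a (a' (c s 0)) (c s 0) :=
    fun s hs => ha _ (hc.time_pos s hs)
  have ha0 : ∀ s ∈ Icc (0 : ℝ) 1, a (c s 0) ≠ 0 := fun s hs => (hpos _ (hc.time_pos s hs)).ne'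
  have hc0 : c 0 0 = τ := by rw [hc.start]; simp [comoving]
  have hc1 : c 0 1 = χ := by rw [hc.start]; simp [comoving]
  have hτ : 0 < τ := hc0 ▸ hc.time_pos 0 h0
  have hu0 : derivWithin c (Icc 0 1) 0 0 = 0 := by
    have h := hc.orthogonal
    rw [metricInner_metric] at h
    simpa [comovingVelocity] using h
  have hmom : ∀ s ∈ Icc (0 : ℝ) 1, a (c s 0) ^ 2 * derivWithin c (Icc 0 1) s 1 =
      a τ ^ 2 * derivWithin c (Icc 0 1) 0 1 := fun s hs => by
    rw [momentum_eq_of_geodesic ha1 ha0 hc.geodesic hs, hc0]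
  have hnorm : ∀ s ∈ Icc (0 : ℝ) 1, -(derivWithin c (Icc 0 1) s 0) ^ 2 +
      a (c s 0) ^ 2 * (derivWithin c (Icc 0 1) s 1) ^ 2 =
        a τ ^ 2 * (derivWithin c (Icc 0 1) 0 1) ^ 2 := fun s hs => by
    have h := metricInner_eq_of_parallel hc.geodesic.1 ha1 ha0 hc.geodesic.2 hc.geodesic.2 hs
    rw [metricInner_metric, metricInner_metric, hu0, hc0] at h
    linarith
  -- The initial velocity has no time component, so being spacelike it must have a radial one.
  have hk0 : derivWithin c (Icc 0 1) 0 1 ≠ 0 := fun h => by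
    have hs := hc.spacelike 0 h0
    rw [metricInner_metric, hu0, h] at hs
    simp at hs
  have hu1 : ∀ s ∈ Icc (0 : ℝ) 1, derivWithin c (Icc 0 1) s 1 ≠ 0 := fun s hs h => by
    have hm := hmom s hs
    rw [h, mul_zero] at hm
    exact mul_ne_zero (pow_ne_zero 2 (hpos τ hτ).ne') hk0 hm.symm
  -- With negative momentum `χ` would decrease along the whole curve, which could then not reach a
  -- coordinate above its initial one.
  have hk : 0 < derivWithin c (Icc 0 1) 0 1 := by
    by_contra hneg
    have hlt : derivWithin c (Icc 0 1) 0 1 < 0 := lt_of_le_of_ne (not_lt.1 hneg) hk0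
    have hanti := strictAntiOn_of_hasDerivWithinAt_neg
      (fun s hs => hasDerivWithinAt_coord hc.geodesic.1 hs 1) fun s hs => by
        have hs' := Ioo_subset_Icc_self hs
        have hm := hmom s hs'
        have h1 : a τ ^ 2 * derivWithin c (Icc 0 1) 0 1 < 0 :=
          mul_neg_of_pos_of_neg (pow_pos (hpos τ hτ) 2) hlt
        rw [← hm] at h1
        exact neg_of_mul_neg_right h1 (sq_nonneg _)
    have := hanti.antitoneOn h0 hs₀ hs₀.1
    linarith
  -- The geodesic equation reads `t'' = -a a' χ'² < 0`; since `t'` starts at `0`, time strictly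
  -- decreases.
  have hu_anti := strictAntiOn_of_hasDerivWithinAt_neg
    (fun s hs => (hc.geodesic.2.hasDerivWithinAt hs (ha1 s hs) (ha0 s hs)).1) fun s hs => by
      have hs' := Ioo_subset_Icc_self hs
      have h1 := hpos _ (hc.time_pos s hs')
      have h2 := hpos' _ (hc.time_pos s hs')
      have h3 := mul_self_pos.2 (hu1 s hs')
      have h4 := mul_pos (mul_pos h1 h2) h3
      linarith
  have hu_neg : ∀ s ∈ Ioc (0 : ℝ) 1, derivWithin c (Icc 0 1) s 0 < 0 := fun s hs => by
    have := hu_anti h0 (Ioc_subset_Icc_self hs) hs.1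
    simp only at this
    rwa [hu0] at this
  have ht_anti := strictAntiOn_of_hasDerivWithinAt_neg
    (fun s hs => hasDerivWithinAt_coord hc.geodesic.1 hs 0)
    fun s hs => hu_neg s (Ioo_subset_Ioc_self hs)
  refine ⟨hk, fun s hs => ?_⟩
  have hs' := Ioc_subset_Icc_self hs
  have := ht_anti h0 hs' hs.1
  simp only [hc0] at this
  exact ⟨hc.time_pos s hs', this, hu_neg s hs, hmom s hs', hnorm s hs'⟩

/-- The kinematic velocity of a comoving particle is determined by the ratio of the scale factors
at the two ends of the geodesic. -/
theorem IsOrthogonalGeodesic.kinematicVelocity {χ τ : ℝ} (hc : IsOrthogonalGeodesic a χ τ c)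
    (ha : ∀ t, 0 < t → HasDerivAt a (a' t) t) (hpos : ∀ t, 0 < t → 0 < a t)
    (hpos' : ∀ t, 0 < t → 0 < a' t) {s : ℝ} (hs : s ∈ Icc (0 : ℝ) 1) (hχ : χ < c s 1)
    {v : ℝ} (hv : IsKinematicVelocity a c s comovingVelocity v) :
    0 < s ∧ 0 < v ∧ 1 - v ^ 2 = (a (c s 0) / a τ) ^ 2 := by
  have h0 : (0 : ℝ) ∈ Icc (0 : ℝ) 1 := by simp
  have ha1 : ∀ s ∈ Icc (0 : ℝ) 1, HasDerivAt a (a' (c s 0)) (c s 0) :=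
    fun s hs => ha _ (hc.time_pos s hs)
  have ha0 : ∀ s ∈ Icc (0 : ℝ) 1, a (c s 0) ≠ 0 := fun s hs => (hpos _ (hc.time_pos s hs)).ne'
  have hc0 : c 0 0 = τ := by rw [hc.start]; simp [comoving]
  have hc1 : c 0 1 = χ := by rw [hc.start]; simp [comoving]
  have hs0 : 0 < s := by
    refine lt_of_le_of_ne hs.1 fun h => ?_
    rw [← h, hc1] at hχ
    exact lt_irrefl _ hχ
  obtain ⟨hk, hkin⟩ := hc.kinematics ha hpos hpos' hs hχ
  obtain ⟨-, -, hu, hmom, hnorm⟩ := hkin s ⟨hs0, hs.2⟩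
  obtain ⟨V, hV, hVs, γ, hV0⟩ := hv
  have hA : 0 < a τ := hpos τ (hc0 ▸ hc.time_pos 0 h0)
  have hB : 0 < a (c s 0) := hpos _ (hc.time_pos s hs)
  have hV00 : V 0 0 = γ := by rw [hV0]; simp [comovingVelocity, unitRadial]
  have hV01 : V 0 1 = γ * v / a τ := by
    rw [hV0]; simp [comovingVelocity, unitRadial, hc0]; ring
  have hu0 : derivWithin c (Icc 0 1) 0 0 = 0 := by
    have h := hc.orthogonal
    rw [metricInner_metric] at h
    simpa [comovingVelocity] using h
  have hVV : ∀ r ∈ Icc (0 : ℝ) 1, -(V r 0 * V r 0) + a (c r 0) ^ 2 * (V r 1 * V r 1) = -1 := by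
    have h := metricInner_eq_of_parallel hc.geodesic.1 ha1 ha0 hV hV hs
    intro r hr
    have h' := metricInner_eq_of_parallel hc.geodesic.1 ha1 ha0 hV hV hr
    rw [← h, metricInner_metric, metricInner_metric, hVs] at h'
    simpa [comovingVelocity] using h'
  have hVu := metricInner_eq_of_parallel hc.geodesic.1 ha1 ha0 hV hc.geodesic.2 hs
  rw [metricInner_metric, metricInner_metric, hVs, hu0, hc0, hV01] at hVu
  simp [comovingVelocity] at hVu
  -- `V⁰` equals `1` at the particle and `γ` at the observer. If `γ ≤ 0` it would vanish in between,
  -- where a vector of squared norm `-1` cannot have zero time component.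
  have hγ : 0 < γ := by
    by_contra hneg
    have hcont : ContinuousOn (fun r => V r 0) (Icc 0 s) := fun r hr =>
      ((hV.hasDerivWithinAt ⟨hr.1, hr.2.trans hs.2⟩ (ha1 r ⟨hr.1, hr.2.trans hs.2⟩)
        (ha0 r ⟨hr.1, hr.2.trans hs.2⟩)).1.continuousWithinAt).mono (Icc_subset_Icc_right hs.2)
    have hmem : (0 : ℝ) ∈ Icc (V 0 0) (V s 0) := by
      rw [hV00, hVs]
      simpa [comovingVelocity] using hneg
    obtain ⟨r, hr, hr0⟩ := intermediate_value_Icc hs.1 hcont hmem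
    have h := hVV r ⟨hr.1, hr.2.trans hs.2⟩
    simp only at hr0
    rw [hr0] at h
    nlinarith [mul_nonneg (sq_nonneg (a (c r 0))) (mul_self_nonneg (V r 1))]
  have hγv := hVV 0 h0
  rw [hV00, hV01, hc0] at hγv
  set k := derivWithin c (Icc 0 1) 0 1
  set u0 := derivWithin c (Icc 0 1) s 0
  set u1 := derivWithin c (Icc 0 1) s 1
  set A := a τ
  set B := a (c s 0)
  -- `e1` is the conserved pairing of `V` with the tangent, and `e2` the normalization of `V`.
  -- Together with the momentum and the norm they determine `γ = A / B`, hence `v`.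
  have e1 : -u0 = A * (γ * v) * k := by rw [hVu]; field_simp
  have e2 : γ ^ 2 * (1 - v ^ 2) = 1 := by
    field_simp at hγv
    linarith
  have e3 : u1 = A ^ 2 * k / B ^ 2 := by rw [← hmom]; field_simp
  have hv0 : 0 < v := by
    have h1 : 0 < A * (γ * v) * k := by linarith
    have h2 := pos_of_mul_pos_left h1 hk.le
    exact pos_of_mul_pos_right (pos_of_mul_pos_right h2 hA.le) hγ.le
  refine ⟨hs0, hv0, ?_⟩
  have e4 : u0 ^ 2 = (A * (γ * v) * k) ^ 2 := by rw [← e1]; ring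
  rw [e4, e3] at hnorm
  have e5 : γ ^ 2 * v ^ 2 = γ ^ 2 - 1 := by linarith
  have e6 : A ^ 2 = γ ^ 2 * B ^ 2 := by
    have h1 : -(A ^ 2 * k ^ 2 * (γ ^ 2 * v ^ 2)) + B ^ 2 * (A ^ 2 * k / B ^ 2) ^ 2 =
      A ^ 2 * k ^ 2 := by linear_combination hnorm
    rw [e5] at h1
    field_simp at h1
    linarith
  rw [div_pow, e6]
  field_simp
  linarith

end Curve

end RW

/-! ### Integration of the geodesic for `a(t) = t^α` -/

namespace RW

theorem hasDerivAt_powerLaw (α : ℝ) (t : ℝ) (ht : 0 < t) :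
    HasDerivAt (fun t : ℝ => t ^ α) (α * t ^ (α - 1)) t :=
  Real.hasDerivAt_rpow_const (Or.inl ht.ne')

section PowerLaw

variable {α χ τ : ℝ} {c : ℝ → Vec}

/-- Along an orthogonal geodesic, `F_α` of the ratio of scale factors is an affine function of
the coordinate `χ`. -/
theorem IsOrthogonalGeodesic.hasDerivAt_funF (hα : 0 < α) (hα1 : α ≠ 1)
    (hc : IsOrthogonalGeodesic (fun t => t ^ α) χ τ c) {s₀ : ℝ}
    (hs₀ : s₀ ∈ Icc (0 : ℝ) 1) (hχ : χ < c s₀ 1) {s : ℝ} (hs : s ∈ Ioo (0 : ℝ) 1) :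
    HasDerivAt (fun r => funF α ((c r 0 / τ) ^ α) + (1 - α) * τ ^ (α - 1) * c r 1) 0 s := by
  obtain ⟨hk, hkin⟩ := hc.kinematics (a' := fun t => α * t ^ (α - 1)) (hasDerivAt_powerLaw α)
    (fun t ht => by positivity) (fun t ht => by positivity) hs₀ hχ
  obtain ⟨ht, htτ, hu, hmom, hnorm⟩ := hkin s (Ioo_subset_Ioc_self hs)
  have hτ : 0 < τ := ht.trans htτ
  have hnhds : Icc (0 : ℝ) 1 ∈ 𝓝 s := Icc_mem_nhds hs.1 hs.2
  have hd0 := (hasDerivWithinAt_coord hc.geodesic.1 (Ioo_subset_Icc_self hs) 0).hasDerivAt hnhds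
  have hd1 := (hasDerivWithinAt_coord hc.geodesic.1 (Ioo_subset_Icc_self hs) 1).hasDerivAt hnhds
  have hy : 0 < c s 0 / τ := div_pos ht hτ
  have hy1 : c s 0 / τ < 1 := (div_lt_one hτ).2 htτ
  have hz : (c s 0 / τ) ^ α ∈ Ioo (0 : ℝ) 1 :=
    ⟨Real.rpow_pos_of_pos hy α, Real.rpow_lt_one hy.le hy1 hα⟩
  have hF := (RW.hasDerivAt_funF hα hα1 hz).comp s
    ((Real.hasDerivAt_rpow_const (p := α) (Or.inl hy.ne')).comp s (hd0.div_const τ))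
  refine (hF.add (hd1.const_mul _)).congr_deriv ?_
  set k := derivWithin c (Icc 0 1) 0 1
  set u0 := derivWithin c (Icc 0 1) s 0
  set u1 := derivWithin c (Icc 0 1) s 1
  set y := c s 0 / τ with hydef
  have hct : c s 0 = y * τ := by rw [hydef]; field_simp
  have hyα := Real.rpow_pos_of_pos hy α
  have hτα := Real.rpow_pos_of_pos hτ α
  rw [hct, Real.mul_rpow hy.le hτ.le] at hmom hnorm
  have hu1 : k = (y ^ α) ^ 2 * u1 := by
    have : (τ ^ α) ^ 2 * ((y ^ α) ^ 2 * u1) = (τ ^ α) ^ 2 * k := by rw [← hmom]; ring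
    exact (mul_left_cancel₀ (by positivity) this).symm
  have hu1pos : 0 < u1 := by
    rw [hu1] at hk
    exact pos_of_mul_pos_right hk (by positivity)
  -- The norm equation solved for `t'`; the root is the one with `t' < 0`.
  have hu0 : -u0 = y ^ α * τ ^ α * u1 * √(1 - (y ^ α) ^ 2) := by
    have h1 : 0 ≤ 1 - (y ^ α) ^ 2 := by nlinarith [hz.1, hz.2]
    rw [← sq_eq_sq₀ (by linarith) (by positivity), mul_pow, Real.sq_sqrt h1]
    rw [hu1] at hnorm
    linear_combination -hnorm
  have hsq : 0 < √(1 - (y ^ α) ^ 2) := Real.sqrt_pos.2 (by nlinarith [hz.1, hz.2])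
  have e1 : (y ^ α) ^ ((1 - α) / α - 1) = y / (y ^ α * y ^ α) := by
    rw [← Real.rpow_mul hy.le, show α * ((1 - α) / α - 1) = 1 - α - α by field_simp,
      Real.rpow_sub hy, Real.rpow_sub hy, Real.rpow_one, div_div]
  have e2 : u0 = -(y ^ α * τ ^ α * u1 * √(1 - (y ^ α) ^ 2)) := by linarith
  rw [e1, e2, Real.rpow_sub_one hy.ne', Real.rpow_sub_one hτ.ne']
  field_simp
  ring

/-- The coordinate distance along an orthogonal geodesic as a function of the ratio of the
scale factors. -/
theorem IsOrthogonalGeodesic.funF_eq (hα : 0 < α) (hα1 : α ≠ 1)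
    (hc : IsOrthogonalGeodesic (fun t => t ^ α) χ τ c) {s : ℝ}
    (hs : s ∈ Ioc (0 : ℝ) 1) (hχ : χ < c s 1) :
    funF α ((c s 0 / τ) ^ α) + (1 - α) * τ ^ (α - 1) * (c s 1 - χ) = constC α := by
  have hs' := Ioc_subset_Icc_self hs
  have h0 : (0 : ℝ) ∈ Icc (0 : ℝ) 1 := by simp
  have hc0 : c 0 0 = τ := by rw [hc.start]; simp [comoving]
  have hc1 : c 0 1 = χ := by rw [hc.start]; simp [comoving]
  have hτ : 0 < τ := hc0 ▸ hc.time_pos 0 h0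
  obtain ⟨-, hkin⟩ := hc.kinematics (a' := fun t => α * t ^ (α - 1)) (hasDerivAt_powerLaw α)
    (fun t ht => by positivity) (fun t ht => by positivity) hs' hχ
  have hz : ∀ r ∈ Ioc (0 : ℝ) 1, (c r 0 / τ) ^ α ∈ Ioo (0 : ℝ) 1 := fun r hr => by
    obtain ⟨ht, htτ, -⟩ := hkin r hr
    exact ⟨Real.rpow_pos_of_pos (div_pos ht hτ) α,
      Real.rpow_lt_one (div_pos ht hτ).le ((div_lt_one hτ).2 htτ) hα⟩
  have hcoord : ∀ r ∈ Icc (0 : ℝ) 1, ∀ i, ContinuousWithinAt (fun r => c r i) (Icc 0 1) r :=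
    fun r hr i => (hasDerivWithinAt_coord hc.geodesic.1 hr i).continuousWithinAt
  have hzc : ∀ r ∈ Icc (0 : ℝ) 1,
      ContinuousWithinAt (fun r => (c r 0 / τ) ^ α) (Icc 0 1) r := fun r hr =>
    ((hcoord r hr 0).div_const τ).rpow_const (Or.inr hα.le)
  have hright : 𝓝[>] (0 : ℝ) = 𝓝[Ioc 0 1] 0 := (nhdsWithin_Ioc_eq_nhdsGT zero_lt_one).symm
  -- At the start the ratio of scale factors is `1`, the endpoint of the domain of `F_α`, so the
  -- limit `C_α` replaces a value there.
  have hlim0 : Tendsto (fun r => funF α ((c r 0 / τ) ^ α) + (1 - α) * τ ^ (α - 1) * c r 1)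
      (𝓝[>] 0) (𝓝 (constC α + (1 - α) * τ ^ (α - 1) * χ)) := by
    rw [hright]
    have h1 : Tendsto (fun r => (c r 0 / τ) ^ α) (𝓝[Ioc 0 1] 0) (𝓝[<] 1) := by
      refine tendsto_nhdsWithin_iff.2 ⟨?_, ?_⟩
      · have h := (hzc 0 h0).mono Ioc_subset_Icc_self
        rw [ContinuousWithinAt, hc0, div_self hτ.ne', Real.one_rpow] at h
        exact h
      · filter_upwards [self_mem_nhdsWithin] with r hr
        exact (hz r hr).2
    have h2 := (hcoord 0 h0 1).mono Ioc_subset_Icc_self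
    rw [ContinuousWithinAt, hc1] at h2
    exact ((tendsto_funF_one hα hα1).comp h1).add (h2.const_mul _)
  have hlims : Tendsto (fun r => funF α ((c r 0 / τ) ^ α) + (1 - α) * τ ^ (α - 1) * c r 1)
      (𝓝[<] s) (𝓝 (funF α ((c s 0 / τ) ^ α) + (1 - α) * τ ^ (α - 1) * c s 1)) := by
    rw [← nhdsWithin_Ioo_eq_nhdsLT hs.1]
    have hsub : Ioo 0 s ⊆ Icc 0 1 := fun r hr => ⟨hr.1.le, hr.2.le.trans hs.2⟩
    have h1 := (RW.hasDerivAt_funF hα hα1 (hz s hs)).continuousAt.comp_continuousWithinAt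
      (f := fun r => (c r 0 / τ) ^ α) ((hzc s hs').mono hsub)
    exact h1.tendsto.add (((hcoord s hs' 1).mono hsub).tendsto.const_mul _)
  -- Cauchy's mean value theorem against the identity, in the form that needs only one-sided limits
  -- at the ends: zero derivative makes the two limits equal.
  obtain ⟨r, -, hr⟩ := exists_ratio_hasDerivAt_eq_ratio_slope' _ (fun _ => 0) hs.1
    id (fun _ => 1)
    (fun r hr => hc.hasDerivAt_funF hα hα1 hs' hχ ⟨hr.1, hr.2.trans_le hs.2⟩)
    (fun r _ => hasDerivAt_id r) hlim0 (tendsto_id.mono_left nhdsWithin_le_nhds) hlims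
    (tendsto_id.mono_left nhdsWithin_le_nhds)
  linarith

/-- The kinematic velocity of a comoving particle determines its ratio of scale factors and its
coordinate distance. -/
theorem IsOrthogonalGeodesic.kinematicVelocity_powerLaw (hα : 0 < α) (hα1 : α ≠ 1)
    (hc : IsOrthogonalGeodesic (fun t => t ^ α) χ τ c) {s χ' τ' : ℝ}
    (hs : s ∈ Icc (0 : ℝ) 1) (hcs : c s = comoving χ' τ') (hχ : χ < χ') {v : ℝ}
    (hv : IsKinematicVelocity (fun t => t ^ α) c s comovingVelocity v) :
    v ∈ Ioo 0 1 ∧ 0 < τ ∧ 0 < τ' ∧ √(1 - v ^ 2) = (τ' / τ) ^ α ∧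
      finv α v = α * τ ^ (α - 1) * (χ' - χ) := by
  have hcs0 : c s 0 = τ' := by rw [hcs]; simp [comoving]
  have hcs1 : c s 1 = χ' := by rw [hcs]; simp [comoving]
  rw [← hcs1] at hχ
  obtain ⟨hs0, hv0, hv1⟩ := hc.kinematicVelocity (a' := fun t => α * t ^ (α - 1))
    (hasDerivAt_powerLaw α) (fun t ht => by positivity) (fun t ht => by positivity) hs hχ hv
  have hτ' : 0 < τ' := hcs0 ▸ hc.time_pos s hs
  have hτ : 0 < τ := by
    have h := hc.time_pos 0 (by simp)
    rw [hc.start] at h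
    simpa [comoving] using h
  rw [hcs0, ← Real.div_rpow hτ'.le hτ.le] at hv1
  have hsqrt : √(1 - v ^ 2) = (τ' / τ) ^ α := by
    rw [hv1]; exact Real.sqrt_sq (by positivity)
  have hlt : v < 1 := by
    have : 0 < ((τ' / τ) ^ α) ^ 2 := by positivity
    nlinarith
  refine ⟨⟨hv0, hlt⟩, hτ, hτ', hsqrt, ?_⟩
  have h := hc.funF_eq hα hα1 ⟨hs0, hs.2⟩ hχ
  rw [hcs0, hcs1] at h
  have hne : α - 1 ≠ 0 := sub_ne_zero.2 hα1
  rw [finv, hsqrt, ← h]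
  field_simp
  ring

end PowerLaw

/-! ### Inversion and the addition formula -/

/-- `f⁻¹` is arranged so that `C_α + (α-1)/α · f⁻¹(v) = F_α(√(1 - v²))`; injectivity recovers `√(1 -
v²)`, and the exponents `1/α` and `2α` combine to a square. -/
theorem funG_finv {α v : ℝ} (hα : 0 < α) (hα1 : α ≠ 1) (hv : v ∈ Ioo (0 : ℝ) 1) :
    constC α + (α - 1) / α * finv α v ∈ funF α '' Ioo 0 1 ∧
      v = √(1 - funG α (finv α v) ^ (2 * α)) := by
  have hne : α - 1 ≠ 0 := sub_ne_zero.2 hα1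
  have hpos : 0 < 1 - v ^ 2 := by nlinarith [hv.1, hv.2]
  have hz : √(1 - v ^ 2) ∈ Ioo (0 : ℝ) 1 := by
    refine ⟨Real.sqrt_pos.2 hpos, ?_⟩
    rw [Real.sqrt_lt' one_pos]
    nlinarith [hv.1]
  have e : constC α + (α - 1) / α * finv α v = funF α √(1 - v ^ 2) := by
    rw [finv]; field_simp; ring
  refine ⟨e ▸ mem_image_of_mem _ hz, ?_⟩
  have hinv : Function.invFunOn (funF α) (Ioo 0 1) (funF α √(1 - v ^ 2)) = √(1 - v ^ 2) :=
    (injOn_funF hα hα1).leftInvOn_invFunOn hz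
  rw [funG, e, hinv, ← Real.rpow_mul hz.1.le, show 1 / α * (2 * α) = (2 : ℕ) by
    push_cast; field_simp, Real.rpow_natCast, Real.sq_sqrt hpos.le, sub_sub_cancel,
    Real.sqrt_sq hv.1.le]

end RW

/-- Kinematic velocity addition for the power-law scale factor `a(t) = t^α` in Scenario I.
The first four conclusions say that all expressions in the formula are well defined. -/
theorem mainTheorem7 (α : ℝ) (hα : 0 < α) (hα1 : α ≠ 1)
    (χ₁ χ₂ τ₀ τ₁ t₂ t₂' s₁ : ℝ) (Ψ₀ Ψ₁ : ℝ → RW.Vec)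
    (hχ₁ : 0 < χ₁) (hχ₂ : χ₁ < χ₂)
    (hI : RW.ScenarioI (fun t => t ^ α) χ₁ χ₂ τ₀ τ₁ t₂ t₂' s₁ Ψ₀ Ψ₁)
    (v₁ v₂ v₃ : ℝ)
    (hv₁ : RW.IsKinematicVelocity (fun t => t ^ α) Ψ₀ s₁ RW.comovingVelocity v₁)
    (hv₂ : RW.IsKinematicVelocity (fun t => t ^ α) Ψ₁ 1 RW.comovingVelocity v₂)
    (hv₃ : RW.IsKinematicVelocity (fun t => t ^ α) Ψ₀ 1 RW.comovingVelocity v₃) :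
    Set.InjOn (RW.funF α) (Set.Ioo 0 1) ∧
    v₁ ∈ Set.Ioo 0 1 ∧ v₂ ∈ Set.Ioo 0 1 ∧
    RW.constC α + (α - 1) / α *
        (RW.finv α v₁ + (1 - v₁ ^ 2) ^ ((1 - α) / (2 * α)) * RW.finv α v₂)
      ∈ RW.funF α '' Set.Ioo 0 1 ∧
    v₃ = √(1 - RW.funG α
        (RW.finv α v₁ + (1 - v₁ ^ 2) ^ ((1 - α) / (2 * α)) * RW.finv α v₂) ^ (2 * α)) := by
  have h1mem : (1 : ℝ) ∈ Set.Icc (0 : ℝ) 1 := by simp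
  obtain ⟨hv₁', hτ₀, hτ₁, hs₁, hf₁⟩ :=
    hI.geodesic₀.kinematicVelocity_powerLaw hα hα1 hI.mem_s₁ hI.meets₁ hχ₁ hv₁
  obtain ⟨hv₂', -, -, -, hf₂⟩ :=
    hI.geodesic₁.kinematicVelocity_powerLaw hα hα1 h1mem hI.meets₂' hχ₂ hv₂
  obtain ⟨hv₃', -, -, -, hf₃⟩ :=
    hI.geodesic₀.kinematicVelocity_powerLaw hα hα1 h1mem hI.meets₂ (hχ₁.trans hχ₂) hv₃
  have hy : 0 < τ₁ / τ₀ := div_pos hτ₁ hτ₀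
  have hpos : 0 ≤ 1 - v₁ ^ 2 := by nlinarith [hv₁'.1, hv₁'.2]
  -- Since `√(1 - v₁²) = (τ₁/τ₀)^α`, the power of `1 - v₁²` is `(τ₁/τ₀)^(1-α)`.
  have hratio : (1 - v₁ ^ 2) ^ ((1 - α) / (2 * α)) * τ₁ ^ (α - 1) = τ₀ ^ (α - 1) := by
    rw [← Real.sq_sqrt hpos, hs₁, ← Real.rpow_natCast, ← Real.rpow_mul hy.le,
      ← Real.rpow_mul hy.le, show α * ((2 : ℕ) : ℝ) * ((1 - α) / (2 * α)) = -(α - 1) by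
        push_cast; field_simp; ring, Real.rpow_neg hy.le, Real.div_rpow hτ₁.le hτ₀.le]
    have := Real.rpow_pos_of_pos hτ₁ (α - 1)
    field_simp
  -- After rescaling to `τ₀`, this is `χ₁ + (χ₂ - χ₁) = χ₂` times `α τ₀^(α-1)`.
  have hadd : RW.finv α v₁ + (1 - v₁ ^ 2) ^ ((1 - α) / (2 * α)) * RW.finv α v₂ =
      RW.finv α v₃ := by
    rw [hf₁, hf₂, hf₃]
    linear_combination α * (χ₂ - χ₁) * hratio
  rw [hadd]
  exact ⟨RW.injOn_funF hα hα1, hv₁', hv₂', RW.funG_finv hα hα1 hv₃'⟩
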